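/- Let $p>2$ be a prime and let $C_k=\frac{1}{k+1}\binom{2k}{k}$ denote the $k$-th Catalan number. Let $\Gamma_p:\mathbb{Z}_p\to\mathbb{Z}_p$ be Morita's $p$-adic Gamma function, that is, the unique continuous extension to the $p$-adic integers $\mathbb{Z}_p$ of the sequence $$n\mapsto(-1)^n\prod_{\substack{0\le k<n\\ (k,p)=1}}k\qquad(n=0,1,2,\dots).$$ Then, where $a\equiv b\pmod{p^2}$ means $a-b\in p^2\mathbb{Z}_p$, $$\sum_{k=0}^{(p-1)/2}\frac{C_k^3}{64^k}\equiv\begin{cases}8 & \text{if } p\equiv 1\pmod 4,\\[2mm] 8-\dfrac{384}{\Gamma_p\left(\frac14\right)^4} & \text{if } p\equiv 3\pmod 4\end{cases}\pmod{p^2}.$$ -/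

import Mathlib

open Filter Topology

/-- The sequence `n ↦ (-1)^n ∏_{0 ≤ k < n, (k,p)=1} k`, with values in `ℤ_[p]`. -/
noncomputable def moritaSeq (p : ℕ) [Fact p.Prime] (n : ℕ) : ℤ_[p] :=
  (-1) ^ n * ∏ k ∈ (Finset.range n).filter (fun k => Nat.Coprime k p), (k : ℤ_[p])

/-- Morita's `p`-adic Gamma function: the extension of `moritaSeq p` to `ℤ_[p]` by continuity, that
is, its value at `x` is the limit of `moritaSeq p n` as the natural number `n` tends to `x` in
`ℤ_[p]`. For odd `p` it is the continuous extension, see `padicGamma_spec` and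
`padicGamma_unique` below. -/
noncomputable def padicGamma (p : ℕ) [Fact p.Prime] (x : ℤ_[p]) : ℤ_[p] :=
  limUnder (comap (Nat.cast : ℕ → ℤ_[p]) (𝓝 x)) (moritaSeq p)

/-- `x ≡ y (mod p^m)` for `p`-adic numbers: `x - y ∈ p^m ℤ_p`. -/
def PadicModEq (p : ℕ) [Fact p.Prime] (m : ℕ) (x y : ℚ_[p]) : Prop :=
  ∃ z : ℤ_[p], x - y = (p : ℚ_[p]) ^ m * (z : ℚ_[p])

/-- The product of all units modulo an odd prime power is `-1`. -/
theorem prod_units_zmod_prime_pow (p : ℕ) [hp : Fact p.Prime] (h2 : 2 < p) (m : ℕ) (hm : m ≠ 0) :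
    ∏ u : (ZMod (p ^ m))ˣ, u = -1 := by
  classical
  have hlt : 2 < p ^ m := lt_of_lt_of_le h2 (Nat.le_self_pow hm p)
  have : Fact (2 < p ^ m) := ⟨hlt⟩
  have hne : (1 : (ZMod (p ^ m))ˣ) ≠ -1 := by
    intro h
    exact ZMod.neg_one_ne_one (n := p ^ m) (by simpa using (congrArg Units.val h).symm)
  have key : ∀ u : (ZMod (p ^ m))ˣ, u = u⁻¹ → u = 1 ∨ u = -1 := by
    intro u hu
    have hsq : (u : ZMod (p ^ m)) * u = 1 := by
      have h1 : u * u = 1 := by nth_rewrite 2 [hu]; simp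
      rw [← Units.val_mul, h1, Units.val_one]
    obtain ⟨a, ha⟩ := ZMod.intCast_surjective (u : ZMod (p ^ m))
    have hdvd : ((p : ℤ) ^ m) ∣ (a - 1) * (a + 1) := by
      have : (((a - 1) * (a + 1) : ℤ) : ZMod (p ^ m)) = 0 := by
        push_cast
        rw [ha]
        linear_combination hsq
      have := (ZMod.intCast_zmod_eq_zero_iff_dvd _ _).1 this
      exact_mod_cast this
    have hpz : Prime (p : ℤ) := Nat.prime_iff_prime_int.1 hp.out
    by_cases h1 : (p : ℤ) ∣ a - 1
    · left
      have h1' : ¬ (p : ℤ) ∣ a + 1 := by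
        intro h
        have h3 : (p : ℤ) ∣ 2 := by
          have := dvd_sub h h1
          ring_nf at this
          exact this
        have := Int.le_of_dvd (by norm_num) h3
        omega
      have := (IsCoprime.pow_left (m := m) ((Prime.coprime_iff_not_dvd hpz).2 h1')).dvd_of_dvd_mul_right hdvd
      have h0 : ((a - 1 : ℤ) : ZMod (p ^ m)) = 0 :=
        (ZMod.intCast_zmod_eq_zero_iff_dvd _ _).2 (by exact_mod_cast this)
      ext
      push_cast at h0
      rw [ha] at h0
      simpa using sub_eq_zero.1 h0
    · right
      have := (IsCoprime.pow_left (m := m) ((Prime.coprime_iff_not_dvd hpz).2 h1)).dvd_of_dvd_mul_left hdvd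
      have h0 : ((a + 1 : ℤ) : ZMod (p ^ m)) = 0 :=
        (ZMod.intCast_zmod_eq_zero_iff_dvd _ _).2 (by exact_mod_cast this)
      ext
      push_cast at h0
      rw [ha] at h0
      simpa using eq_neg_of_add_eq_zero_left h0
  have hrest : ∏ u ∈ Finset.univ \ ({1, -1} : Finset (ZMod (p ^ m))ˣ), u = 1 := by
    refine Finset.prod_involution (fun u _ => u⁻¹) ?_ ?_ ?_ ?_
    · intro u _
      simp
    · intro u hu _ h
      simp only [Finset.mem_sdiff, Finset.mem_univ, Finset.mem_insert, Finset.mem_singleton,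
        true_and] at hu
      exact hu (key u h.symm)
    · intro u hu
      simp only [Finset.mem_sdiff, Finset.mem_univ, Finset.mem_insert, Finset.mem_singleton,
        true_and, not_or] at hu ⊢
      refine ⟨fun h => hu.1 (inv_eq_one.1 h), fun h => hu.2 ?_⟩
      rw [← inv_inv u, h]
      simp
    · intro u _
      simp
  rw [← Finset.prod_sdiff (Finset.subset_univ ({1, -1} : Finset (ZMod (p ^ m))ˣ)), hrest,
    Finset.prod_pair hne]
  simp

theorem prod_range_shift_of_periodic {R : Type*} [CommMonoid R] (g : ℕ → R) (N : ℕ)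
    (hg : ∀ i, g (i + N) = g i) (n : ℕ) :
    ∏ i ∈ Finset.range N, g (n + i) = ∏ i ∈ Finset.range N, g i := by
  cases N with
  | zero => simp
  | succ M =>
    induction n with
    | zero => simp
    | succ n ih =>
      rw [← ih, Finset.prod_range_succ, Finset.prod_range_succ']
      congr 1
      · refine Finset.prod_congr rfl fun i _ => ?_
        congr 1
        omega
      · rw [← hg (n + 0)]
        congr 1
        omega

/-- `moritaSeq p` is periodic modulo `p^m` with period `p^m`. -/
theorem toZModPow_moritaSeq_add (p : ℕ) [hp : Fact p.Prime] (h2 : 2 < p) (m : ℕ) (hm : m ≠ 0)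
    (n : ℕ) :
    PadicInt.toZModPow m (moritaSeq p (n + p ^ m)) = PadicInt.toZModPow m (moritaSeq p n) := by
  classical
  have : NeZero (p ^ m) := ⟨pow_ne_zero _ hp.out.ne_zero⟩
  let h : ZMod (p ^ m) → ZMod (p ^ m) := fun z => if IsUnit z then z else 1
  have hs : ∀ n, PadicInt.toZModPow m (moritaSeq p n) =
      (-1) ^ n * ∏ k ∈ Finset.range n, h (k : ZMod (p ^ m)) := by
    intro n
    simp only [moritaSeq, Finset.prod_filter, map_mul, map_pow, map_neg, map_one, map_prod, h]
    congr 1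
    refine Finset.prod_congr rfl fun k _ => ?_
    have hk : IsUnit (k : ZMod (p ^ m)) ↔ k.Coprime p := by
      rw [ZMod.isUnit_iff_coprime, Nat.coprime_pow_right_iff (Nat.pos_of_ne_zero hm)]
    by_cases hkp : k.Coprime p
    · rw [if_pos hkp, if_pos (hk.2 hkp), map_natCast]
    · rw [if_neg hkp, if_neg (fun h => hkp (hk.1 h)), map_one]
  have hblock : ∀ n : ℕ, ∏ i ∈ Finset.range (p ^ m), h ((n + i : ℕ) : ZMod (p ^ m)) =
      ∏ i ∈ Finset.range (p ^ m), h ((i : ℕ) : ZMod (p ^ m)) := by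
    intro n
    refine prod_range_shift_of_periodic (fun i : ℕ => h (i : ZMod (p ^ m))) (p ^ m) ?_ n
    intro i
    show h ((i + p ^ m : ℕ) : ZMod (p ^ m)) = h (i : ZMod (p ^ m))
    rw [Nat.cast_add, ZMod.natCast_self, add_zero]
  have hall : ∏ i ∈ Finset.range (p ^ m), h ((i : ℕ) : ZMod (p ^ m)) = -1 := by
    have e1 : ∏ i ∈ Finset.range (p ^ m), h ((i : ℕ) : ZMod (p ^ m)) = ∏ z, h z := by
      refine Finset.prod_bij' (fun i _ => (i : ZMod (p ^ m))) (fun z _ => z.val) ?_ ?_ ?_ ?_ ?_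
      · intro i _
        exact Finset.mem_univ _
      · intro z _
        exact Finset.mem_range.2 (ZMod.val_lt z)
      · intro i hi
        exact ZMod.val_cast_of_lt (Finset.mem_range.1 hi)
      · intro z _
        exact ZMod.natCast_zmod_val z
      · intro i _
        rfl
    have e2 : ∏ u : (ZMod (p ^ m))ˣ, (u : ZMod (p ^ m)) = ∏ z, h z := by
      refine Fintype.prod_of_injective (fun u : (ZMod (p ^ m))ˣ => (u : ZMod (p ^ m)))
        Units.val_injective _ _ ?_ ?_
      · intro z hz
        have : ¬ IsUnit z := fun hu => hz ⟨hu.unit, rfl⟩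
        simp [h, this]
      · intro u
        simp [h]
    rw [e1, ← e2, ← Units.coe_prod, prod_units_zmod_prime_pow p h2 m hm]
    simp
  rw [hs, hs, Finset.prod_range_add, hblock, hall, pow_add]
  have hodd : Odd (p ^ m) := (hp.out.odd_of_ne_two (by omega)).pow
  rw [hodd.neg_one_pow]
  ring

theorem toZModPow_moritaSeq_congr (p : ℕ) [hp : Fact p.Prime] (h2 : 2 < p) (m : ℕ) (hm : m ≠ 0)
    (a b : ℕ) (hab : (a : ℤ_[p]) - b ∈ Ideal.span {(p : ℤ_[p]) ^ m}) :
    moritaSeq p a - moritaSeq p b ∈ Ideal.span {(p : ℤ_[p]) ^ m} := by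
  have hmul : ∀ n t : ℕ, PadicInt.toZModPow m (moritaSeq p (n + p ^ m * t)) =
      PadicInt.toZModPow m (moritaSeq p n) := by
    intro n t
    induction t with
    | zero => simp
    | succ t ih => rw [Nat.mul_succ, ← add_assoc, toZModPow_moritaSeq_add p h2 m hm, ih]
  have hmod : a % p ^ m = b % p ^ m := by
    rw [← PadicInt.ker_toZModPow, RingHom.mem_ker, map_sub, sub_eq_zero, map_natCast,
      map_natCast] at hab
    exact (ZMod.natCast_eq_natCast_iff' _ _ _).1 hab
  rw [← PadicInt.ker_toZModPow, RingHom.mem_ker, map_sub, sub_eq_zero,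
    ← Nat.mod_add_div a (p ^ m), ← Nat.mod_add_div b (p ^ m), hmul, hmul, hmod]

theorem moritaSeq_tendsto (p : ℕ) [hp : Fact p.Prime] (h2 : 2 < p) (x : ℤ_[p]) :
    ∃ c, Tendsto (moritaSeq p) (comap (Nat.cast : ℕ → ℤ_[p]) (𝓝 x)) (𝓝 c) := by
  have : (comap (Nat.cast : ℕ → ℤ_[p]) (𝓝 x)).NeBot := by
    rw [comap_neBot_iff]
    intro t ht
    obtain ⟨y, hy, n, rfl⟩ := mem_closure_iff_nhds.1 (PadicInt.denseRange_natCast x) t ht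
    exact ⟨n, hy⟩
  have hc : Cauchy (map (moritaSeq p) (comap (Nat.cast : ℕ → ℤ_[p]) (𝓝 x))) := by
    rw [Metric.cauchy_iff]
    refine ⟨inferInstance, fun ε hε => ?_⟩
    obtain ⟨k, hk⟩ := PadicInt.exists_pow_neg_lt p hε
    have hp1 : (1 : ℝ) < p := by exact_mod_cast hp.out.one_lt
    have hr : (0 : ℝ) < (p : ℝ) ^ (-((k + 1 : ℕ) : ℤ)) := by positivity
    refine ⟨moritaSeq p '' ((Nat.cast : ℕ → ℤ_[p]) ⁻¹'
      Metric.ball x ((p : ℝ) ^ (-((k + 1 : ℕ) : ℤ)))),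
      image_mem_map (preimage_mem_comap (Metric.ball_mem_nhds x hr)), ?_⟩
    rintro _ ⟨a, ha, rfl⟩ _ ⟨b, hb, rfl⟩
    have hab : ‖(a : ℤ_[p]) - b‖ ≤ (p : ℝ) ^ (-((k + 1 : ℕ) : ℤ)) := by
      have e : (a : ℤ_[p]) - b = (a - x) + (x - b) := by ring
      rw [e]
      refine (PadicInt.nonarchimedean _ _).trans (max_le ?_ ?_)
      · exact (mem_ball_iff_norm.1 ha).le
      · rw [norm_sub_rev]
        exact (mem_ball_iff_norm.1 hb).le
    have := (PadicInt.norm_le_pow_iff_mem_span_pow _ _).2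
      (toZModPow_moritaSeq_congr p h2 (k + 1) (Nat.succ_ne_zero k) a b
        ((PadicInt.norm_le_pow_iff_mem_span_pow _ _).1 hab))
    rw [dist_eq_norm]
    refine lt_of_le_of_lt (this.trans ?_) hk
    exact zpow_le_zpow_right₀ hp1.le (by push_cast; omega)
  obtain ⟨c, hc⟩ := CompleteSpace.complete hc
  exact ⟨c, hc⟩

/-- For odd `p`, `padicGamma p` is continuous on `ℤ_[p]` and extends `moritaSeq p`. -/
theorem padicGamma_spec (p : ℕ) [Fact p.Prime] (h2 : 2 < p) :
    Continuous (padicGamma p) ∧ ∀ n : ℕ, padicGamma p n = moritaSeq p n := by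
  let _ : TopologicalSpace ℕ := TopologicalSpace.induced (Nat.cast : ℕ → ℤ_[p]) inferInstance
  have hi : IsDenseInducing (Nat.cast : ℕ → ℤ_[p]) := ⟨⟨rfl⟩, PadicInt.denseRange_natCast⟩
  exact ⟨hi.continuous_extend (moritaSeq_tendsto p h2),
    hi.extend_eq' (moritaSeq_tendsto p h2)⟩

/-- For odd `p`, `padicGamma p` is the only continuous extension of `moritaSeq p`. -/
theorem padicGamma_unique (p : ℕ) [Fact p.Prime] (h2 : 2 < p) (g : ℤ_[p] → ℤ_[p])
    (hg : Continuous g) (hgn : ∀ n : ℕ, g n = moritaSeq p n) : g = padicGamma p :=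
  PadicInt.denseRange_natCast.equalizer hg (padicGamma_spec p h2).1
    (funext fun n => (hgn n).trans ((padicGamma_spec p h2).2 n).symm)

/-- The element `1/4` of `ℤ_[p]` (for odd `p`). -/
noncomputable def padicQuarter (p : ℕ) [Fact p.Prime] : ℤ_[p] := PadicInt.inv 4

theorem coe_padicQuarter (p : ℕ) [hp : Fact p.Prime] (h2 : 2 < p) :
    (padicQuarter p : ℚ_[p]) = 1 / 4 := by
  have hd : ¬ p ∣ 4 := by
    intro h
    have h' : p ∣ 2 ^ 2 := h
    have := Nat.le_of_dvd (by norm_num) (hp.out.dvd_of_dvd_pow h')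
    omega
  have hn : ‖(4 : ℤ_[p])‖ = 1 := by
    have := PadicInt.norm_natCast_eq_one_iff (p := p) (n := 4)
    exact_mod_cast this.2 ((Nat.Prime.coprime_iff_not_dvd hp.out).2 hd)
  have h4 : (4 : ℚ_[p]) * (padicQuarter p : ℚ_[p]) = 1 :=
    congrArg (fun z : ℤ_[p] => (z : ℚ_[p])) (PadicInt.mul_inv hn)
  rw [eq_div_iff (by norm_num)]
  linear_combination h4

/-! Put (x)_j = x(x+1)...(x+j-1), m = (p+1)/2 and h = p/2. Since C_k/4^k = -2 (-1/2)_{k+1}/(k+1)!,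
the sum equals 8 - 8T with T the sum of ((-1/2)_j/j!)^3 over 0 ≤ j ≤ m (`sum_catalan_cube`).

Replace two of the three upper parameters -1/2 by -1/2 ± h and two of the lower parameters 1 by 1 ±
h. The linear terms in h cancel and all denominators are units, so each term moves only by a
multiple of p^2 (`norm_cube_sub_wellPoised_le`). As -1/2 - h = -m, the new series is well-poised and
terminates at j = m, and Dixon's theorem (`dixon_sum`) gives its sum: X = (1/2)_m (5/4-h)_m /
((3/4)_m (1-h)_m).

If p ≡ 1 (mod 4), the numerator contains the factors p/2 and -p/4 while the denominator is a unit,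
so X ≡ 0. If p ≡ 3 (mod 4), the p/2 above meets p/4 below. The functional equation and reflection of
Γ_p then give the exact value (`dixon_value_mul_padicGamma`) X = 3 / ((1/4-h)(1/4+h) Γ_p(1/4-h)
Γ_p(1/4+h) Γ_p(1/4)^2). Modulo p^2 the two linear factors multiply to 1/16 and the two shifted Gamma
values to Γ_p(1/4)^2 (`p_sq_dvd_padicGamma_midpoint`), so X ≡ 48/Γ_p(1/4)^4. -/

/-! ### Dixon's summation theorem -/

/-- The recurrence in `n` behind Dixon's theorem, in telescoped form. -/
theorem dixon_telescope {K : Type*} [Field K] [CharZero K] (a b : K) (n : ℕ)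
    (h1 : ∀ i : ℕ, 1 + a - b + i ≠ 0) (h2 : ∀ i : ℕ, 1 + a + i ≠ 0) (k : ℕ) :
    ∑ j ∈ Finset.range (k + 1),
      ((a + 2 * (n + 1)) * (a - b + (n + 1)) *
          ((-1) ^ j * ((n + 1).choose j : K) *
            ((∏ i ∈ Finset.range j, (a + i)) * ∏ i ∈ Finset.range j, (b + i)) /
            ((∏ i ∈ Finset.range j, (1 + a - b + i)) *
              ∏ i ∈ Finset.range j, (1 + a + (n + 1 : ℕ) + i))) -
        (a + (n + 1)) * (a - 2 * b + 2 * (n + 1)) *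
          ((-1) ^ j * (n.choose j : K) *
            ((∏ i ∈ Finset.range j, (a + i)) * ∏ i ∈ Finset.range j, (b + i)) /
            ((∏ i ∈ Finset.range j, (1 + a - b + i)) *
              ∏ i ∈ Finset.range j, (1 + a + n + i)))) =
      (-1) ^ k * (n.choose k : K) *
        ((∏ i ∈ Finset.range (k + 1), (a + i)) * ∏ i ∈ Finset.range (k + 1), (b + i)) /
        ((∏ i ∈ Finset.range k, (1 + a - b + i)) *
          ∏ i ∈ Finset.range k, (1 + a + (n + 1 : ℕ) + i)) := by
  have h2' : ∀ x y : ℕ, 1 + a + x + y ≠ 0 := fun x y => by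
    have := h2 (x + y); push_cast at this; rwa [← add_assoc] at this
  have hN : a + (n + 1) ≠ 0 := by have := h2 n; contrapose! this; linear_combination this
  have hp1 : ∀ k, ∏ i ∈ Finset.range k, (1 + a - b + (i : K)) ≠ 0 := fun k =>
    Finset.prod_ne_zero_iff.2 fun i _ => h1 i
  have hp2 : ∀ x k : ℕ, ∏ i ∈ Finset.range k, (1 + a + (x : K) + (i : K)) ≠ 0 := fun x k =>
    Finset.prod_ne_zero_iff.2 fun i _ => h2' x i
  -- The sums for `n` and `n + 1` have different lower parameters; this brings both to the one for
  -- `n + 1`.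
  have hshift : ∀ k : ℕ, ∏ i ∈ Finset.range k, (1 + a + (n : K) + (i : K)) =
      (a + (n + 1)) * (∏ i ∈ Finset.range k, (1 + a + ((n + 1 : ℕ) : K) + (i : K))) /
        (a + (n + 1) + k) := by
    intro k
    have hk : a + (n + 1) + k ≠ 0 := by
      have := h2' n k; contrapose! this; linear_combination this
    rw [eq_div_iff hk]
    clear hk
    induction k with
    | zero => simp
    | succ k ih =>
      rw [Finset.prod_range_succ, Finset.prod_range_succ]
      push_cast at ih ⊢
      linear_combination (a + (n + 1) + (k + 1)) * ih
  induction k with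
  | zero => simp; ring
  | succ k ih =>
    rw [Finset.sum_range_succ, ih]
    have hc : (n.choose (k + 1) : K) = (n - k) * (n.choose k : K) / (k + 1) := by
      rw [eq_div_iff (Nat.cast_add_one_ne_zero k)]
      have := Nat.choose_succ_right_eq n k
      rcases le_or_gt k n with hkn | hkn
      · have h' : ((n.choose (k + 1) * (k + 1) : ℕ) : K) = ((n.choose k * (n - k) : ℕ) : K) := by
          rw [this]
        push_cast [Nat.cast_sub hkn] at h'
        linear_combination h'
      · rw [Nat.choose_eq_zero_of_lt hkn, Nat.choose_eq_zero_of_lt (by omega)]; simp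
    have hk1 : (k : K) + 1 ≠ 0 := Nat.cast_add_one_ne_zero k
    have hk : a + (n + 1) + (k + 1) ≠ 0 := by
      have := h2' n (k + 1); contrapose! this; push_cast at this ⊢; linear_combination this
    have e1 := hp1 k
    have e2 := hp2 (n + 1) k
    have e3 := h1 k
    have e4 := h2' (n + 1) k
    rw [hshift, Nat.choose_succ_succ, Nat.cast_add (n.choose k) (n.choose k.succ), hc,
      Finset.prod_range_succ (fun i : ℕ => a + (i : K)) (k + 1),
      Finset.prod_range_succ (fun i : ℕ => b + (i : K)) (k + 1),
      Finset.prod_range_succ (fun i : ℕ => 1 + a - b + (i : K)) k,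
      Finset.prod_range_succ (fun i : ℕ => 1 + a + ((n + 1 : ℕ) : K) + (i : K)) k]
    generalize (∏ i ∈ Finset.range k, (1 + a - b + (i : K))) = X at *
    generalize (∏ i ∈ Finset.range k, (1 + a + ((n + 1 : ℕ) : K) + (i : K))) = Y at *
    generalize (∏ i ∈ Finset.range (k + 1), (a + (i : K))) = Z at *
    generalize (∏ i ∈ Finset.range (k + 1), (b + (i : K))) = W at *
    push_cast at *
    clear hp1 hp2 h2' h1 h2 hshift ih hc
    generalize (n.choose k : K) = c at *
    rw [pow_succ]
    generalize ((-1 : K) ^ k) = s at *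
    field_simp
    ring

/-- Dixon's theorem for a terminating well-poised `₃F₂(1)`. -/
theorem dixon_sum {K : Type*} [Field K] [CharZero K] (a b : K)
    (h1 : ∀ i : ℕ, 1 + a - b + i ≠ 0) (h2 : ∀ i : ℕ, 1 + a + i ≠ 0)
    (h3 : ∀ i : ℕ, 1 + a / 2 + i ≠ 0) (n : ℕ) :
    ∑ j ∈ Finset.range (n + 1),
      ((-1) ^ j * (n.choose j : K) *
        ((∏ i ∈ Finset.range j, (a + i)) * ∏ i ∈ Finset.range j, (b + i)) /
        ((∏ i ∈ Finset.range j, (1 + a - b + i)) * ∏ i ∈ Finset.range j, (1 + a + n + i))) =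
      (∏ i ∈ Finset.range n, (1 + a + i)) * (∏ i ∈ Finset.range n, (1 + a / 2 - b + i)) /
        ((∏ i ∈ Finset.range n, (1 + a / 2 + i)) * ∏ i ∈ Finset.range n, (1 + a - b + i)) := by
  induction n with
  | zero => simp
  | succ n ih =>
    -- At this cutoff the telescoped boundary term carries `n.choose (n + 1) = 0`, leaving a
    -- two-term recurrence between consecutive sums.
    have key := dixon_telescope a b n h1 h2 (n + 1)
    rw [Finset.sum_sub_distrib, ← Finset.mul_sum, ← Finset.mul_sum, Nat.choose_succ_self,
      Finset.sum_range_succ (fun j => (-1) ^ j * (n.choose j : K) * _ / _) (n + 1),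
      Nat.choose_succ_self, ih] at key
    simp only [Nat.cast_zero, mul_zero, zero_mul, zero_div, add_zero] at key
    have hA : a + 2 * (n + 1) ≠ 0 := by have := h3 n; contrapose! this; linear_combination this / 2
    have hB : a - b + (n + 1) ≠ 0 := by have := h1 n; contrapose! this; linear_combination this
    have e1 : ∏ i ∈ Finset.range n, (1 + a - b + (i : K)) ≠ 0 :=
      Finset.prod_ne_zero_iff.2 fun i _ => h1 i
    have e2 : ∏ i ∈ Finset.range n, (1 + a / 2 + (i : K)) ≠ 0 :=
      Finset.prod_ne_zero_iff.2 fun i _ => h3 i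
    refine mul_left_cancel₀ (mul_ne_zero hA hB) ((sub_eq_zero.1 key).trans ?_)
    have e3 := h1 n
    have e4 := h3 n
    simp only [Finset.prod_range_succ _ n]
    generalize (∏ i ∈ Finset.range n, (1 + a - b + (i : K))) = X at *
    generalize (∏ i ∈ Finset.range n, (1 + a / 2 + (i : K))) = Y at *
    generalize (∏ i ∈ Finset.range n, (1 + a + (i : K))) = Z at *
    generalize (∏ i ∈ Finset.range n, (1 + a / 2 - b + (i : K))) = W at *
    clear key ih h1 h2 h3
    rw [show 1 + a / 2 + (n : K) = (a + 2 * (n + 1)) / 2 by ring,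
      show 1 + a - b + (n : K) = a - b + (n + 1) by ring]
    generalize hD : a + 2 * ((n : K) + 1) = D at *
    generalize hE : a - b + ((n : K) + 1) = E at *
    field_simp
    ring

/-! ### Catalan numbers as binomial coefficients of 1/2 -/

theorem neg_half_pochhammer_div_factorial {K : Type*} [Field K] [CharZero K] (k : ℕ) :
    (∏ i ∈ Finset.range (k + 1), (-1 / 2 + (i : K))) / ∏ i ∈ Finset.range (k + 1), (1 + (i : K)) =
      -(catalan k : K) / (2 * 4 ^ k) := by
  induction k with
  | zero => simp
  | succ k ih =>
    have h1 : (k : K) + 1 ≠ 0 := Nat.cast_add_one_ne_zero k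
    have h2 : (k : K) + 1 + 1 ≠ 0 := by exact_mod_cast Nat.cast_add_one_ne_zero (R := K) (k + 1)
    have e1 : ((k : K) + 1) * catalan k = k.centralBinom := by
      exact_mod_cast succ_mul_catalan_eq_centralBinom k
    have e2 : ((k : K) + 1 + 1) * catalan (k + 1) = (k + 1).centralBinom := by
      exact_mod_cast succ_mul_catalan_eq_centralBinom (k + 1)
    have e3 : ((k : K) + 1) * (k + 1).centralBinom = 2 * (2 * k + 1) * k.centralBinom := by
      exact_mod_cast Nat.succ_mul_centralBinom_succ k
    have e4 : (catalan (k + 1) : K) = 2 * (2 * k + 1) * catalan k / (k + 1 + 1) := by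
      rw [eq_div_iff h2]
      refine mul_left_cancel₀ h1 ?_
      rw [← e1, ← e2] at e3
      linear_combination e3
    rw [Finset.prod_range_succ _ (k + 1), Finset.prod_range_succ _ (k + 1), mul_div_mul_comm, ih,
      e4]
    have h3 : 1 + ((k + 1 : ℕ) : K) ≠ 0 := by push_cast; rwa [add_comm]
    have h4 : (1 + ((k + 1 : ℕ) : K)) = k + 1 + 1 := by push_cast; ring
    rw [h4]
    push_cast
    field_simp
    ring

/-- The index shift j = k + 1 leaves j = 0 uncovered; adding that term, which is 1, accounts for the
constant 8. For n = (p-1)/2 the last index is (p+1)/2, exactly where the deformed series terminates.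
-/
theorem sum_catalan_cube {K : Type*} [Field K] [CharZero K] (n : ℕ) :
    ∑ k ∈ Finset.Icc 0 n, (catalan k : K) ^ 3 / 64 ^ k =
      8 - 8 * ∑ j ∈ Finset.range (n + 2),
        ((∏ i ∈ Finset.range j, (-1 / 2 + (i : K))) / ∏ i ∈ Finset.range j, (1 + (i : K))) ^ 3 := by
  rw [Finset.sum_range_succ', ← Nat.range_succ_eq_Icc_zero]
  simp only [neg_half_pochhammer_div_factorial, Finset.prod_range_zero, div_one, one_pow]
  rw [mul_add, ← sub_sub, mul_one, sub_right_comm, sub_self, zero_sub, Finset.mul_sum,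
    ← Finset.sum_neg_distrib]
  refine Finset.sum_congr rfl fun k _ => ?_
  rw [show (64 : K) = 4 ^ 3 by norm_num, ← pow_mul, mul_comm 3, pow_mul]
  field_simp
  norm_num

/-! ### Functional equation, reflection and congruences for Γ_p -/

section PadicGamma

variable {p : ℕ} [hp : Fact p.Prime]

theorem isClosed_setOf_pow_dvd {X : Type*} [TopologicalSpace X] {f : X → ℤ_[p]}
    (hf : Continuous f) (m : ℕ) : IsClosed {x | (p : ℤ_[p]) ^ m ∣ f x} := by
  have : {x | (p : ℤ_[p]) ^ m ∣ f x} = {x | ‖f x‖ ≤ (p : ℝ) ^ (-(m : ℤ))} := by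
    ext x
    rw [Set.mem_ofPred_eq, Set.mem_ofPred_eq, PadicInt.norm_le_pow_iff_mem_span_pow,
      Ideal.mem_span_singleton]
  rw [this]
  exact isClosed_le hf.norm continuous_const

/-- Divisibility by p^m is a closed condition, so the congruence for `moritaSeq` extends by density
in both the base point and the increment. -/
theorem pow_dvd_padicGamma_sub (h2 : 2 < p) {m : ℕ} (hm : m ≠ 0) {x y : ℤ_[p]}
    (h : (p : ℤ_[p]) ^ m ∣ x - y) : (p : ℤ_[p]) ^ m ∣ padicGamma p x - padicGamma p y := by
  obtain ⟨t, ht⟩ := h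
  obtain rfl : x = y + (p : ℤ_[p]) ^ m * t := by linear_combination ht
  clear ht
  have hc := (padicGamma_spec p h2).1
  refine PadicInt.denseRange_natCast.induction_on₂
    (p := fun y t => (p : ℤ_[p]) ^ m ∣ padicGamma p (y + (p : ℤ_[p]) ^ m * t) - padicGamma p y)
    (isClosed_setOf_pow_dvd (by fun_prop) m) (fun a b => ?_) y t
  have e := (padicGamma_spec p h2).2
  rw [← Nat.cast_pow, ← Nat.cast_mul, ← Nat.cast_add, e, e, Nat.cast_pow,
    ← Ideal.mem_span_singleton]
  refine toZModPow_moritaSeq_congr p h2 m hm _ _ (Ideal.mem_span_singleton.2 ⟨b, ?_⟩)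
  push_cast
  ring

theorem isUnit_natCast_padicInt {n : ℕ} : IsUnit (n : ℤ_[p]) ↔ n.Coprime p := by
  rw [PadicInt.isUnit_iff, PadicInt.norm_natCast_eq_one_iff, Nat.coprime_comm]

theorem isClosed_setOf_isUnit_padicInt : IsClosed {x : ℤ_[p] | IsUnit x} := by
  simp only [PadicInt.isUnit_iff]
  exact isClosed_eq continuous_norm continuous_const

theorem padicGamma_add_one_of_isUnit (h2 : 2 < p) {x : ℤ_[p]} (hx : IsUnit x) :
    padicGamma p (x + 1) = -x * padicGamma p x := by
  have hc := (padicGamma_spec p h2).1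
  have e := (padicGamma_spec p h2).2
  have : ¬ IsUnit x ∨ padicGamma p (x + 1) = -x * padicGamma p x := by
    refine PadicInt.denseRange_natCast.induction_on
      (p := fun x => ¬ IsUnit x ∨ padicGamma p (x + 1) = -x * padicGamma p x) x ?_ fun n => ?_
    -- The units are open, so the disjunction is a closed condition and it suffices to check natural
    -- numbers.
    · exact (Units.isOpen.isClosed_compl).union (isClosed_eq (by fun_prop) (by fun_prop))
    · by_cases hn : n.Coprime p
      · right
        rw [← Nat.cast_succ, e, e, moritaSeq, moritaSeq, Nat.succ_eq_add_one,
          Finset.range_add_one, Finset.filter_insert, if_pos hn, Finset.prod_insert (by simp)]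
        ring
      · exact Or.inl fun h => hn (isUnit_natCast_padicInt.1 h)
  exact this.resolve_left (not_not.2 hx)

theorem padicGamma_add_one_of_not_isUnit (h2 : 2 < p) {x : ℤ_[p]} (hx : ¬ IsUnit x) :
    padicGamma p (x + 1) = -padicGamma p x := by
  have hc := (padicGamma_spec p h2).1
  have e := (padicGamma_spec p h2).2
  have : IsUnit x ∨ padicGamma p (x + 1) = -padicGamma p x := by
    refine PadicInt.denseRange_natCast.induction_on
      (p := fun x => IsUnit x ∨ padicGamma p (x + 1) = -padicGamma p x) x ?_ fun n => ?_
    · exact isClosed_setOf_isUnit_padicInt.union (isClosed_eq (by fun_prop) (by fun_prop))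
    · by_cases hn : n.Coprime p
      · exact Or.inl (isUnit_natCast_padicInt.2 hn)
      · right
        rw [← Nat.cast_succ, e, e, moritaSeq, moritaSeq, Nat.succ_eq_add_one,
          Finset.range_add_one, Finset.filter_insert, if_neg hn]
        ring
  exact this.resolve_left hx

open Classical in
/-- `x` itself if `x` is a unit, and `1` otherwise. -/
noncomputable def unitPart (p : ℕ) [Fact p.Prime] (x : ℤ_[p]) : ℤ_[p] := if IsUnit x then x else 1

theorem padicGamma_add_one (h2 : 2 < p) (x : ℤ_[p]) :
    padicGamma p (x + 1) = -unitPart p x * padicGamma p x := by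
  by_cases hx : IsUnit x
  · rw [padicGamma_add_one_of_isUnit h2 hx, unitPart, if_pos hx]
  · rw [padicGamma_add_one_of_not_isUnit h2 hx, unitPart, if_neg hx, neg_one_mul]

theorem padicGamma_add_natCast (h2 : 2 < p) (x : ℤ_[p]) (k : ℕ) :
    padicGamma p (x + k) =
      (-1) ^ k * (∏ i ∈ Finset.range k, unitPart p (x + i)) * padicGamma p x := by
  induction k with
  | zero => simp
  | succ k ih =>
    rw [Nat.cast_succ, ← add_assoc, padicGamma_add_one h2, ih, Finset.prod_range_succ]
    ring

theorem padicGamma_zero (h2 : 2 < p) : padicGamma p 0 = 1 := by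
  have := (padicGamma_spec p h2).2 0
  simpa [moritaSeq] using this

theorem padicGamma_reflect_add_one_of_isUnit (h2 : 2 < p) {x : ℤ_[p]} (hx : IsUnit x) :
    padicGamma p (x + 1) * padicGamma p (1 - (x + 1)) =
      -(padicGamma p x * padicGamma p (1 - x)) := by
  have h := padicGamma_add_one_of_isUnit h2 hx.neg
  rw [neg_neg, neg_add_eq_sub] at h
  rw [padicGamma_add_one_of_isUnit h2 hx, h, show 1 - (x + 1) = -x by ring]
  ring

theorem padicGamma_reflect_add_one_of_not_isUnit (h2 : 2 < p) {x : ℤ_[p]} (hx : ¬ IsUnit x) :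
    padicGamma p (x + 1) * padicGamma p (1 - (x + 1)) = padicGamma p x * padicGamma p (1 - x) := by
  have h := padicGamma_add_one_of_not_isUnit h2 (x := -x) (by rwa [IsUnit.neg_iff])
  rw [neg_add_eq_sub] at h
  rw [padicGamma_add_one_of_not_isUnit h2 hx, h, show 1 - (x + 1) = -x by ring]
  ring

theorem padicGamma_zero_mul_one (h2 : 2 < p) : padicGamma p 0 * padicGamma p (1 - 0) = -1 := by
  have := padicGamma_add_one_of_not_isUnit h2 (x := 0) not_isUnit_zero
  rw [zero_add, padicGamma_zero h2] at this
  rw [sub_zero, this, padicGamma_zero h2, one_mul]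

/-- Each unit step flips the sign of the product and each non-unit step preserves it. The square
avoids tracking that sign. -/
theorem padicGamma_reflect_sq (h2 : 2 < p) (x : ℤ_[p]) :
    (padicGamma p x * padicGamma p (1 - x)) ^ 2 = 1 := by
  have hc := (padicGamma_spec p h2).1
  refine PadicInt.denseRange_natCast.induction_on
    (p := fun x => (padicGamma p x * padicGamma p (1 - x)) ^ 2 = 1) x
    (isClosed_eq (by fun_prop) (by fun_prop)) fun n => ?_
  induction n with
  | zero => rw [Nat.cast_zero, padicGamma_zero_mul_one h2]; ring
  | succ n ih =>
    rw [Nat.cast_succ]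
    by_cases hx : IsUnit (n : ℤ_[p])
    · rw [padicGamma_reflect_add_one_of_isUnit h2 hx, neg_sq, ih]
    · rw [padicGamma_reflect_add_one_of_not_isUnit h2 hx, ih]

theorem isUnit_padicGamma (h2 : 2 < p) (x : ℤ_[p]) : IsUnit (padicGamma p x) :=
  isUnit_of_mul_isUnit_left (IsUnit.of_pow_eq_one (padicGamma_reflect_sq h2 x) two_ne_zero)

theorem isUnit_iff_not_p_dvd {x : ℤ_[p]} : IsUnit x ↔ ¬ (p : ℤ_[p]) ∣ x := by
  rw [← PadicInt.norm_lt_one_iff_dvd, ← PadicInt.mem_nonunits, mem_nonunits_iff, not_not]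

theorem isUnit_p_mul_add_natCast {x : ℤ_[p]} {i : ℕ} (hi : i ≠ 0) (hip : i < p) :
    IsUnit ((p : ℤ_[p]) * x + i) := by
  rw [isUnit_iff_not_p_dvd, ← dvd_sub_right (dvd_mul_right _ x), ← dvd_neg,
    show -((p : ℤ_[p]) * x - ((p : ℤ_[p]) * x + i)) = i by ring, ← isUnit_iff_not_p_dvd,
    isUnit_natCast_padicInt]
  exact (Nat.coprime_of_lt_prime hi hip hp.out).symm

theorem padicGamma_reflect_p_mul_add (h2 : 2 < p) (x : ℤ_[p]) {i : ℕ} (hi : i < p) :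
    padicGamma p (p * x + (i + 1)) * padicGamma p (1 - (p * x + (i + 1))) =
      (-1) ^ i * (padicGamma p (p * x) * padicGamma p (1 - p * x)) := by
  induction i with
  | zero =>
    rw [Nat.cast_zero, zero_add, padicGamma_reflect_add_one_of_not_isUnit h2, pow_zero, one_mul]
    rw [isUnit_iff_not_p_dvd, not_not]
    exact dvd_mul_right _ _
  | succ i ih =>
    have := padicGamma_reflect_add_one_of_isUnit h2
      (isUnit_p_mul_add_natCast (x := x) (Nat.succ_ne_zero i) hi)
    rw [Nat.cast_succ] at this ⊢
    rw [← add_assoc, this, ih (by omega)]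
    ring

/-- Here the sign is determined: going from pn to p(n+1) takes one non-unit step and p - 1 unit
steps, an even number of sign changes. -/
theorem padicGamma_reflect_p_mul (h2 : 2 < p) (x : ℤ_[p]) :
    padicGamma p (p * x) * padicGamma p (1 - p * x) = -1 := by
  have hc := (padicGamma_spec p h2).1
  refine PadicInt.denseRange_natCast.induction_on
    (p := fun x => padicGamma p ((p : ℤ_[p]) * x) * padicGamma p (1 - (p : ℤ_[p]) * x) = -1) x
    (isClosed_eq (by fun_prop) (by fun_prop)) fun n => ?_
  induction n with
  | zero => rw [Nat.cast_zero, mul_zero, padicGamma_zero_mul_one h2]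
  | succ n ih =>
    have := padicGamma_reflect_p_mul_add h2 n (i := p - 1) (by omega)
    rw [ih, Nat.cast_sub (by omega), Nat.cast_one, sub_add_cancel,
      (hp.out.even_sub_one (by omega)).neg_one_pow, one_mul] at this
    rw [← this]
    push_cast
    ring_nf

theorem p_sq_dvd_prod_one_add_sub {ι : Type*} (s : Finset ι) (d : ι → ℤ_[p]) :
    (p : ℤ_[p]) ^ 2 ∣ ∏ i ∈ s, (1 + p * d i) - (1 + p * ∑ i ∈ s, d i) := by
  classical
  induction s using Finset.induction_on with
  | empty => simp
  | insert a s ha ih =>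
    obtain ⟨c, hc⟩ := ih
    rw [Finset.prod_insert ha, Finset.sum_insert ha]
    exact ⟨(1 + p * d a) * c + d a * ∑ i ∈ s, d i, by linear_combination (1 + p * d a) * hc⟩

/-- Both inverses are 0 by convention on non-invertible elements, so no unit hypothesis is needed.
-/
theorem toZMod_inverse (x : ℤ_[p]) :
    PadicInt.toZMod (Ring.inverse x) = (PadicInt.toZMod x)⁻¹ := by
  by_cases hx : IsUnit x
  · refine eq_inv_of_mul_eq_one_left ?_
    rw [← map_mul, Ring.inverse_mul_cancel x hx, map_one]
  · have : PadicInt.toZMod x = 0 := by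
      rw [← RingHom.mem_ker, PadicInt.ker_toZMod]
      exact hx
    rw [Ring.inverse_non_unit x hx, this, map_zero, inv_zero]

theorem sum_inv_zmod (h2 : 2 < p) : ∑ z : ZMod p, z⁻¹ = 0 := by
  have := FiniteField.sum_pow_lt_card_sub_one (ZMod p) 1 (by rw [ZMod.card]; omega)
  rw [← this]
  simp only [pow_one]
  exact (inv_involutive.bijective : Function.Bijective fun z : ZMod p => z⁻¹).sum_comp fun z => z

/-- The x + i run through all residues mod p, and inversion permutes `ZMod p` (with 0 fixed), so the
sum reduces to the sum of all residues, which is 0 for odd p. -/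
theorem p_dvd_sum_inverse (h2 : 2 < p) (x : ℤ_[p]) :
    (p : ℤ_[p]) ∣ ∑ i ∈ Finset.range p, Ring.inverse (x + i) := by
  rw [← Ideal.mem_span_singleton, ← PadicInt.maximalIdeal_eq_span_p, ← PadicInt.ker_toZMod,
    RingHom.mem_ker, map_sum, ← sum_inv_zmod h2]
  simp only [toZMod_inverse, map_add, map_natCast]
  rw [← Equiv.sum_comp (Equiv.addLeft (PadicInt.toZMod x))]
  refine Finset.sum_bij' (fun i _ => (i : ZMod p)) (fun z _ => z.val) ?_ ?_ ?_ ?_ ?_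
  · exact fun i _ => Finset.mem_univ _
  · exact fun z _ => Finset.mem_range.2 (ZMod.val_lt z)
  · exact fun i hi => ZMod.val_cast_of_lt (Finset.mem_range.1 hi)
  · exact fun z _ => ZMod.natCast_zmod_val z
  · exact fun i _ => rfl

theorem unitPart_add_p (x : ℤ_[p]) :
    unitPart p (x + p) = unitPart p x * (1 + p * Ring.inverse x) := by
  have h : IsUnit (x + p) ↔ IsUnit x := by
    rw [isUnit_iff_not_p_dvd, isUnit_iff_not_p_dvd, dvd_add_self_right]
  by_cases hx : IsUnit x
  · rw [unitPart, unitPart, if_pos (h.2 hx), if_pos hx]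
    linear_combination -(p : ℤ_[p]) * Ring.mul_inverse_cancel x hx
  · rw [unitPart, unitPart, if_neg (fun h' => hx (h.1 h')), if_neg hx, Ring.inverse_non_unit x hx]
    ring

/-- The product of the units in a block of length `p` has period `p` modulo `p^2`. -/
theorem p_sq_dvd_prod_unitPart_sub (h2 : 2 < p) (x : ℤ_[p]) :
    (p : ℤ_[p]) ^ 2 ∣ ∏ i ∈ Finset.range p, unitPart p (x + p + i) -
      ∏ i ∈ Finset.range p, unitPart p (x + i) := by
  obtain ⟨c, hc⟩ := p_sq_dvd_prod_one_add_sub (p := p) (Finset.range p) fun i : ℕ => Ring.inverse (x + i)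
  obtain ⟨d, hd⟩ := p_dvd_sum_inverse h2 x
  have : ∏ i ∈ Finset.range p, unitPart p (x + p + i) = (∏ i ∈ Finset.range p, unitPart p (x + i)) *
      ∏ i ∈ Finset.range p, (1 + p * (Ring.inverse (x + i) : ℤ_[p])) := by
    rw [← Finset.prod_mul_distrib]
    refine Finset.prod_congr rfl fun i _ => ?_
    rw [← unitPart_add_p]
    congr 1
    ring
  refine ⟨(∏ i ∈ Finset.range p, unitPart p (x + i)) * (c + d), ?_⟩
  rw [hd] at hc
  rw [this]
  linear_combination (∏ i ∈ Finset.range p, unitPart p (x + i)) * hc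

theorem toZModPow_eq_of_dvd {m : ℕ} {x y : ℤ_[p]} (h : (p : ℤ_[p]) ^ m ∣ x - y) :
    PadicInt.toZModPow m x = PadicInt.toZModPow m y := by
  rwa [← sub_eq_zero, ← map_sub, ← RingHom.mem_ker, PadicInt.ker_toZModPow,
    Ideal.mem_span_singleton]

/-- Modulo `p^2`, `padicGamma p` is geometric along progressions with difference `p`; in
particular its value at a midpoint is the geometric mean. -/
theorem p_sq_dvd_padicGamma_midpoint (h2 : 2 < p) (y h : ℤ_[p]) (hh : 2 * h = p) :
    (p : ℤ_[p]) ^ 2 ∣ padicGamma p y * padicGamma p (y + p) - padicGamma p (y + h) ^ 2 := by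
  set φ := PadicInt.toZModPow (p := p) 2 with hφ
  set r := φ (-∏ i ∈ Finset.range p, unitPart p (y + i)) with hr
  have hodd : Odd p := hp.out.odd_of_ne_two (by omega)
  have hB : ∀ t : ℕ, φ (∏ i ∈ Finset.range p, unitPart p (y + p * t + i)) =
      φ (∏ i ∈ Finset.range p, unitPart p (y + i)) := by
    intro t
    induction t with
    | zero => simp
    | succ t ih =>
      rw [← ih, ← toZModPow_eq_of_dvd (p_sq_dvd_prod_unitPart_sub h2 (y + p * t))]
      congr 1
      refine Finset.prod_congr rfl fun i _ => ?_
      congr 1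
      push_cast
      ring
  have hU : ∀ t : ℕ, φ (padicGamma p (y + p * t)) = r ^ t * φ (padicGamma p y) := by
    intro t
    induction t with
    | zero => simp
    | succ t ih =>
      rw [show y + p * ((t + 1 : ℕ) : ℤ_[p]) = y + p * t + p by push_cast; ring,
        padicGamma_add_natCast h2, hodd.neg_one_pow, map_mul, ih, neg_one_mul, map_neg, hB, hr,
        map_neg]
      ring
  have hu : IsUnit (φ (padicGamma p y)) := (isUnit_padicGamma h2 y).map φ
  -- p steps of length p shift the argument by p^2, which does not change the value modulo p^2.
  have hrp : r ^ p = 1 := by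
    refine hu.mul_right_cancel ?_
    rw [← hU, one_mul]
    exact toZModPow_eq_of_dvd (pow_dvd_padicGamma_sub h2 two_ne_zero ⟨1, by ring⟩)
  obtain ⟨s, hs⟩ := hodd
  -- With p = 2s + 1, p(s+1) = p/2 + p^2/2, so h amounts to s + 1 steps modulo p^2. Squaring gives
  -- r^(2s+2) = r^(p+1) = r.
  have hm : φ (padicGamma p (y + h)) = r ^ (s + 1) * φ (padicGamma p y) := by
    rw [← hU]
    refine toZModPow_eq_of_dvd (pow_dvd_padicGamma_sub h2 two_ne_zero ⟨h - (s + 1), ?_⟩)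
    have : (p : ℤ_[p]) = 2 * s + 1 := by exact_mod_cast congrArg (Nat.cast (R := ℤ_[p])) hs
    push_cast
    linear_combination (s + 1 + p * (h - s - 1) - p * h) * hh + h * (1 - p) * this
  have h1 := hU 1
  rw [Nat.cast_one, mul_one, pow_one] at h1
  rw [← Ideal.mem_span_singleton, ← PadicInt.ker_toZModPow, RingHom.mem_ker, map_sub, map_mul,
    map_pow, h1, hm]
  replace hrp : r ^ (2 * s + 1) = 1 := by rwa [← hs]
  linear_combination -r * φ (padicGamma p y) ^ 2 * hrp

end PadicGamma

/-! ### Deforming the cubes to a well-poised series modulo p^2 -/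

section Congruence

variable {p : ℕ} [hp : Fact p.Prime]

theorem norm_prod_sub_prod_le {K : Type*} [NormedField K] [IsUltrametricDist K] {ι : Type*}
    (s : Finset ι) (u v : ι → K) {ε : ℝ} (hε : 0 ≤ ε) (hu : ∀ i ∈ s, ‖u i‖ ≤ 1)
    (hv : ∀ i ∈ s, ‖v i‖ ≤ 1) (huv : ∀ i ∈ s, ‖u i - v i‖ ≤ ε) :
    ‖∏ i ∈ s, u i - ∏ i ∈ s, v i‖ ≤ ε := by
  classical
  induction s using Finset.induction_on with
  | empty => simpa using hε
  | insert a s ha ih =>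
    simp only [Finset.forall_mem_insert] at hu hv huv
    rw [Finset.prod_insert ha, Finset.prod_insert ha,
      show u a * ∏ i ∈ s, u i - v a * ∏ i ∈ s, v i =
        u a * (∏ i ∈ s, u i - ∏ i ∈ s, v i) + (u a - v a) * ∏ i ∈ s, v i by ring]
    refine (IsUltrametricDist.norm_add_le_max _ _).trans (max_le ?_ ?_)
    · rw [norm_mul]
      exact (mul_le_of_le_one_left (norm_nonneg _) hu.1).trans (ih hu.2 hv.2 huv.2)
    · rw [norm_mul, norm_prod]
      exact (mul_le_of_le_one_right (norm_nonneg _)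
        (Finset.prod_le_one (fun _ _ => norm_nonneg _) hv.2)).trans huv.1

theorem norm_sub_le_max_norm {E : Type*} [SeminormedAddCommGroup E] [IsUltrametricDist E] (x y : E) :
    ‖x - y‖ ≤ max ‖x‖ ‖y‖ := by
  rw [sub_eq_add_neg, ← norm_neg y]
  exact IsUltrametricDist.norm_add_le_max _ _

theorem norm_prod_le_of_mem {K : Type*} [NormedField K] {ι : Type*} {s : Finset ι} {u : ι → K}
    (hu : ∀ i ∈ s, ‖u i‖ ≤ 1) {j : ι} (hj : j ∈ s) : ‖∏ i ∈ s, u i‖ ≤ ‖u j‖ := by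
  classical
  rw [← Finset.mul_prod_erase s u hj, norm_mul, norm_prod]
  exact mul_le_of_le_one_right (norm_nonneg _)
    (Finset.prod_le_one (fun _ _ => norm_nonneg _) fun i hi => hu i (Finset.mem_of_mem_erase hi))

theorem padicModEq_iff_norm_le {m : ℕ} {x y : ℚ_[p]} :
    PadicModEq p m x y ↔ ‖x - y‖ ≤ (p : ℝ) ^ (-(m : ℤ)) := by
  have hp0 : (p : ℚ_[p]) ≠ 0 := by exact_mod_cast hp.out.ne_zero
  constructor
  · rintro ⟨z, hz⟩
    rw [hz, norm_mul, Padic.norm_p_pow]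
    exact mul_le_of_le_one_right (by positivity) z.2
  · intro h
    refine ⟨⟨(x - y) / (p : ℚ_[p]) ^ m, ?_⟩, ?_⟩
    · rw [norm_div, Padic.norm_p_pow]
      exact div_le_one_of_le₀ h (by positivity)
    · exact (mul_div_cancel₀ _ (pow_ne_zero _ hp0)).symm

/-- Every factor below lies in (1/4)ℤ and 4 is a p-adic unit, so norms reduce to divisibility of
integers. -/
theorem norm_eq_norm_intCast_of_four_mul (h2 : 2 < p) {x : ℚ_[p]} {n : ℤ} (h : 4 * x = n) :
    ‖x‖ = ‖(n : ℚ_[p])‖ := by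
  have h4 : ‖(4 : ℚ_[p])‖ = 1 := by
    have : p.Coprime 4 := by
      rw [show 4 = 2 ^ 2 by norm_num]
      exact Nat.Coprime.pow_right 2 ((Nat.coprime_primes hp.out Nat.prime_two).2 (by omega))
    exact_mod_cast Padic.norm_natCast_eq_one_iff.2 this
  rw [← h, norm_mul, h4, one_mul]

theorem norm_le_one_of_four_mul (h2 : 2 < p) {x : ℚ_[p]} {n : ℤ} (h : 4 * x = n) : ‖x‖ ≤ 1 := by
  rw [norm_eq_norm_intCast_of_four_mul h2 h]
  exact Padic.norm_int_le_one n

theorem norm_eq_one_of_four_mul (h2 : 2 < p) {x : ℚ_[p]} {n : ℤ} (h : 4 * x = n)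
    (hn : ¬ (p : ℤ) ∣ n) : ‖x‖ = 1 := by
  rw [norm_eq_norm_intCast_of_four_mul h2 h]
  exact le_antisymm (Padic.norm_int_le_one n)
    (not_lt.1 fun h' => hn ((Padic.norm_intCast_lt_one_iff).1 h'))

theorem norm_half_p (h2 : 2 < p) : ‖(p : ℚ_[p]) / 2‖ = (p : ℝ)⁻¹ := by
  rw [norm_div, Padic.norm_p]
  have : ‖(2 : ℚ_[p])‖ = 1 := by
    exact_mod_cast Padic.norm_natCast_eq_one_iff.2
      ((Nat.coprime_primes hp.out Nat.prime_two).2 (by omega))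
  rw [this, div_one]

theorem not_dvd_of_pos_of_lt {p : ℕ} {n : ℤ} (h0 : 0 < n) (h1 : n < p) : ¬ (p : ℤ) ∣ n := fun h =>
  absurd (Int.le_of_dvd h0 h) (not_le.2 h1)

theorem not_dvd_four_mul (h2 : 2 < p) {n : ℤ} (h0 : 0 < n) (h1 : n < p) : ¬ (p : ℤ) ∣ 4 * n := by
  intro h
  have hpz : Prime (p : ℤ) := Nat.prime_iff_prime_int.1 hp.out
  rcases hpz.dvd_or_dvd h with h | h
  · have h' : (p : ℤ) ∣ 2 := hpz.dvd_of_dvd_pow (n := 2) (by norm_num [h])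
    have := Int.le_of_dvd (by norm_num) h'
    omega
  · exact not_dvd_of_pos_of_lt h0 h1 h

/-- The deformation of the cubed coefficients to a terminating well-poised series does not change
them modulo `p^2`. -/
theorem norm_cube_sub_wellPoised_le (h2 : 2 < p) {m : ℕ} (hm : 2 * m = p + 1) {j : ℕ}
    (hj : j ≤ m) :
    ‖((∏ i ∈ Finset.range j, (-1 / 2 + (i : ℚ_[p]))) / ∏ i ∈ Finset.range j, (1 + (i : ℚ_[p]))) ^ 3 -
      (-1) ^ j * (m.choose j : ℚ_[p]) *
        ((∏ i ∈ Finset.range j, (-1 / 2 + (i : ℚ_[p]))) *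
          ∏ i ∈ Finset.range j, ((m - 1 : ℚ_[p]) + i)) /
        ((∏ i ∈ Finset.range j, (1 + (-1 / 2) - (m - 1 : ℚ_[p]) + i)) *
          ∏ i ∈ Finset.range j, (1 + (-1 / 2) + (m : ℚ_[p]) + i))‖ ≤ (p : ℝ) ^ (-(2 : ℕ) : ℤ) := by
  have hmp : (m : ℚ_[p]) = 1 / 2 + p / 2 := by
    have : (2 : ℚ_[p]) * m = p + 1 := by exact_mod_cast hm
    linear_combination this / 2
  set h : ℚ_[p] := p / 2 with hh
  have hH : ‖h‖ ^ 2 = (p : ℝ) ^ (-(2 : ℕ) : ℤ) := by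
    rw [hh, norm_half_p h2, zpow_neg, inv_pow, zpow_natCast]
  have hh1 : ‖h‖ ≤ 1 := norm_le_one_of_four_mul h2 (n := 2 * p) (by push_cast; rw [hh]; ring)
  have n1 : ∀ i : ℕ, ‖-1 / 2 + (i : ℚ_[p])‖ ≤ 1 := fun i =>
    norm_le_one_of_four_mul h2 (n := -2 + 4 * i) (by push_cast; ring)
  have n2 : ∀ i : ℕ, i < j → ‖1 + (i : ℚ_[p])‖ = 1 := fun i hi =>
    norm_eq_one_of_four_mul h2 (n := 4 * (1 + i)) (by push_cast; ring)
      (not_dvd_four_mul h2 (by omega) (by omega))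
  have n3 : ∀ i : ℕ, i < j → ‖1 + (i : ℚ_[p]) - h‖ = 1 := fun i hi =>
    norm_eq_one_of_four_mul h2 (n := 4 * (1 + i) - p * 2) (by push_cast; rw [hh]; ring)
      (fun hd => not_dvd_four_mul h2 (n := 1 + i) (by omega) (by omega)
        ((dvd_sub_left (dvd_mul_right _ _)).1 hd))
  have n4 : ∀ i : ℕ, i < j → ‖1 + (i : ℚ_[p]) + h‖ = 1 := fun i hi =>
    norm_eq_one_of_four_mul h2 (n := 4 * (1 + i) + p * 2) (by push_cast; rw [hh]; ring)
      (fun hd => not_dvd_four_mul h2 (n := 1 + i) (by omega) (by omega)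
        ((dvd_add_left (dvd_mul_right _ _)).1 hd))
  have hne : ∀ {x : ℚ_[p]}, ‖x‖ = 1 → x ≠ 0 := fun hx h0 => by simp [h0] at hx
  -- The left side is (-m)_j/j!, and -m = -1/2 - h.
  have hchoose : (-1) ^ j * (m.choose j : ℚ_[p]) =
      (∏ i ∈ Finset.range j, (-1 / 2 + (i : ℚ_[p]) - h)) /
        ∏ i ∈ Finset.range j, (1 + (i : ℚ_[p])) := by
    clear n2 n3 n4
    induction j with
    | zero => simp
    | succ j ih =>
      have h1 : (1 : ℚ_[p]) + j ≠ 0 := by rw [add_comm]; exact Nat.cast_add_one_ne_zero j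
      have hc : (m.choose (j + 1) : ℚ_[p]) * (j + 1) = m.choose j * (m - j) := by
        have h' : ((m.choose (j + 1) * (j + 1) : ℕ) : ℚ_[p]) = ((m.choose j * (m - j) : ℕ) : _) := by
          rw [Nat.choose_succ_right_eq m j]
        push_cast [Nat.cast_sub (by omega : j ≤ m)] at h'
        exact h'
      rw [Finset.prod_range_succ, Finset.prod_range_succ, mul_div_mul_comm, ← ih (by omega),
        ← mul_div_assoc, eq_div_iff h1]
      linear_combination (-1) ^ (j + 1) * hc + (-1) ^ j * (m.choose j : ℚ_[p]) * (-1) * hmp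
  have e1 : ∏ i ∈ Finset.range j, ((m - 1 : ℚ_[p]) + i) =
      ∏ i ∈ Finset.range j, (-1 / 2 + (i : ℚ_[p]) + h) :=
    Finset.prod_congr rfl fun i _ => by rw [hmp]; ring
  have e2 : ∏ i ∈ Finset.range j, (1 + (-1 / 2) - (m - 1 : ℚ_[p]) + i) =
      ∏ i ∈ Finset.range j, (1 + (i : ℚ_[p]) - h) :=
    Finset.prod_congr rfl fun i _ => by rw [hmp]; ring
  have e3 : ∏ i ∈ Finset.range j, (1 + (-1 / 2) + (m : ℚ_[p]) + i) =
      ∏ i ∈ Finset.range j, (1 + (i : ℚ_[p]) + h) :=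
    Finset.prod_congr rfl fun i _ => by rw [hmp]; ring
  -- Factor by factor, (s-h)(s+h) = s^2 - h^2 differs from s^2 only in second order, and likewise
  -- below. The remaining third factor is p-integral.
  have key : ‖∏ i ∈ Finset.range j, ((-1 / 2 + (i : ℚ_[p])) ^ 2 / (1 + (i : ℚ_[p])) ^ 2) -
      ∏ i ∈ Finset.range j, ((-1 / 2 + (i : ℚ_[p]) - h) * (-1 / 2 + (i : ℚ_[p]) + h) /
        ((1 + (i : ℚ_[p]) - h) * (1 + (i : ℚ_[p]) + h)))‖ ≤ ‖h‖ ^ 2 := by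
    refine norm_prod_sub_prod_le _ _ _ (by positivity) (fun i hi => ?_) (fun i hi => ?_)
      fun i hi => ?_
    · have hi := Finset.mem_range.1 hi
      rw [norm_div, norm_pow, norm_pow, n2 i hi, one_pow, div_one]
      exact pow_le_one₀ (norm_nonneg _) (n1 i)
    · have hi := Finset.mem_range.1 hi
      rw [norm_div, norm_mul, norm_mul, n3 i hi, n4 i hi, mul_one, div_one]
      refine mul_le_one₀ ?_ (norm_nonneg _) ?_
      · exact (norm_sub_le_max_norm _ _).trans (max_le (n1 i) hh1)
      · exact (IsUltrametricDist.norm_add_le_max _ _).trans (max_le (n1 i) hh1)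
    · have hi := Finset.mem_range.1 hi
      have z2 := hne (n2 i hi)
      have z3 := hne (n3 i hi)
      have z4 := hne (n4 i hi)
      rw [show (-1 / 2 + (i : ℚ_[p])) ^ 2 / (1 + (i : ℚ_[p])) ^ 2 -
          (-1 / 2 + (i : ℚ_[p]) - h) * (-1 / 2 + (i : ℚ_[p]) + h) /
            ((1 + (i : ℚ_[p]) - h) * (1 + (i : ℚ_[p]) + h)) =
          h ^ 2 * ((1 + (i : ℚ_[p])) ^ 2 - (-1 / 2 + (i : ℚ_[p])) ^ 2) /
            ((1 + (i : ℚ_[p])) ^ 2 * ((1 + (i : ℚ_[p]) - h) * (1 + (i : ℚ_[p]) + h))) by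
        generalize (-1 / 2 + (i : ℚ_[p])) = s at *
        generalize (1 + (i : ℚ_[p])) = t at *
        field_simp
        ring]
      rw [norm_div, norm_mul, norm_mul, norm_mul, norm_pow, norm_pow, n2 i hi, n3 i hi, n4 i hi,
        one_pow, mul_one, mul_one, div_one]
      refine mul_le_of_le_one_right (by positivity)
        ((norm_sub_le_max_norm _ _).trans (max_le ?_ ?_))
      · rw [norm_pow, n2 i hi, one_pow]
      · rw [norm_pow]
        exact pow_le_one₀ (norm_nonneg _) (n1 i)
  rw [hchoose, e1, e2, e3, ← hH]
  have hx : ‖(∏ i ∈ Finset.range j, (-1 / 2 + (i : ℚ_[p]))) /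
      ∏ i ∈ Finset.range j, (1 + (i : ℚ_[p]))‖ ≤ 1 := by
    rw [norm_div, norm_prod, norm_prod,
      Finset.prod_eq_one (s := Finset.range j) (f := fun i => ‖1 + (i : ℚ_[p])‖)
        fun i hi => n2 i (Finset.mem_range.1 hi), div_one]
    exact Finset.prod_le_one (fun _ _ => norm_nonneg _) fun i _ => n1 i
  refine le_trans (le_of_eq ?_) ((mul_le_of_le_one_left (norm_nonneg _) hx).trans key)
  rw [← norm_mul]
  congr 1
  simp only [Finset.prod_div_distrib, Finset.prod_mul_distrib, Finset.prod_pow]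
  ring

theorem norm_sum_cube_sub_dixon_le (h2 : 2 < p) {m : ℕ} (hm : 2 * m = p + 1) :
    ‖∑ j ∈ Finset.range (m + 1), ((∏ i ∈ Finset.range j, (-1 / 2 + (i : ℚ_[p]))) /
        ∏ i ∈ Finset.range j, (1 + (i : ℚ_[p]))) ^ 3 -
      (∏ i ∈ Finset.range m, (1 / 2 + (i : ℚ_[p]))) *
        (∏ i ∈ Finset.range m, (5 / 4 - (p : ℚ_[p]) / 2 + i)) /
        ((∏ i ∈ Finset.range m, (3 / 4 + (i : ℚ_[p]))) *
          ∏ i ∈ Finset.range m, (1 - (p : ℚ_[p]) / 2 + i))‖ ≤ (p : ℝ) ^ (-(2 : ℕ) : ℤ) := by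
  have hmp : (m : ℚ_[p]) = 1 / 2 + p / 2 := by
    have : (2 : ℚ_[p]) * m = p + 1 := by exact_mod_cast hm
    linear_combination this / 2
  have hz : ∀ n : ℤ, n ≠ 0 → ∀ x : ℚ_[p], 4 * x = n → x ≠ 0 := by
    rintro n hn x hx rfl
    rw [mul_zero] at hx
    exact hn (by exact_mod_cast hx.symm)
  -- Dixon with a = -1/2, b = m - 1 = -1/2 + p/2 and n = m. The first nonvanishing condition holds
  -- because p is odd.
  have key := dixon_sum (-1 / 2 : ℚ_[p]) (m - 1)
    (fun i => hz (4 + 4 * i - 2 * p) (by have := hp.out.odd_of_ne_two (by omega); grind) _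
      (by rw [hmp]; push_cast; ring))
    (fun i => hz (2 + 4 * i) (by omega) _ (by push_cast; ring))
    (fun i => hz (3 + 4 * i) (by omega) _ (by push_cast; ring)) m
  rw [show (1 + -1 / 2 : ℚ_[p]) = 1 / 2 by norm_num,
    show (1 + -1 / 2 / 2 : ℚ_[p]) = 3 / 4 by norm_num,
    show (3 / 4 - (m - 1 : ℚ_[p])) = 5 / 4 - p / 2 by rw [hmp]; ring] at key
  have e : (1 / 2 - (m - 1 : ℚ_[p])) = 1 - p / 2 := by rw [hmp]; ring
  rw [← e, ← key, ← Finset.sum_sub_distrib]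
  refine IsUltrametricDist.norm_sum_le_of_forall_le_of_nonneg (by positivity) fun j hj => ?_
  have := norm_cube_sub_wellPoised_le h2 hm (j := j) (by have := Finset.mem_range.1 hj; omega)
  rwa [show (1 + (-1 / 2) : ℚ_[p]) = 1 / 2 by norm_num] at this

end Congruence

/-! ### Evaluating Dixon's product in the two residue classes -/

section Evaluation

variable {p : ℕ} [hp : Fact p.Prime]

@[simp, norm_cast]
theorem coe_ofNat_padicInt (n : ℕ) [n.AtLeastTwo] :
    ((ofNat(n) : ℤ_[p]) : ℚ_[p]) = ofNat(n) :=
  map_ofNat PadicInt.Coe.ringHom n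

@[simp, norm_cast]
theorem coe_prod_padicInt {ι : Type*} (s : Finset ι) (f : ι → ℤ_[p]) :
    ((∏ i ∈ s, f i : ℤ_[p]) : ℚ_[p]) = ∏ i ∈ s, (f i : ℚ_[p]) :=
  map_prod PadicInt.Coe.ringHom f s

theorem norm_dixon_le_of_mod_four_eq_one (h2 : 2 < p) {m : ℕ} (hm : 2 * m = p + 1)
    (hp4 : p % 4 = 1) :
    ‖(∏ i ∈ Finset.range m, (1 / 2 + (i : ℚ_[p]))) *
        (∏ i ∈ Finset.range m, (5 / 4 - (p : ℚ_[p]) / 2 + i)) /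
        ((∏ i ∈ Finset.range m, (3 / 4 + (i : ℚ_[p]))) *
          ∏ i ∈ Finset.range m, (1 - (p : ℚ_[p]) / 2 + i))‖ ≤ (p : ℝ) ^ (-(2 : ℕ) : ℤ) := by
  have hmp : (m : ℚ_[p]) = 1 / 2 + p / 2 := by
    have : (2 : ℚ_[p]) * m = p + 1 := by exact_mod_cast hm
    linear_combination this / 2
  obtain ⟨r, hr⟩ : ∃ r, p = 4 * r + 5 := ⟨(p - 5) / 4, by have := hp.out.two_le; omega⟩
  have hrp : (r : ℚ_[p]) = p / 4 - 5 / 4 := by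
    have : (p : ℚ_[p]) = 4 * r + 5 := by exact_mod_cast congrArg (Nat.cast (R := ℚ_[p])) hr
    linear_combination -this / 4
  have a1 : ‖∏ i ∈ Finset.range m, (1 / 2 + (i : ℚ_[p]))‖ ≤ (p : ℝ)⁻¹ := by
    refine (norm_prod_le_of_mem (fun (i : ℕ) _ => norm_le_one_of_four_mul h2 (n := 2 + 4 * i)
      (by push_cast; ring)) (Finset.mem_range.2 (show m - 1 < m by omega))).trans (le_of_eq ?_)
    rw [Nat.cast_sub (by omega), hmp, ← norm_half_p h2]
    congr 1
    push_cast
    ring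
  -- With p = 4r + 5, the factor at i = r is -p/4.
  have a2 : ‖∏ i ∈ Finset.range m, (5 / 4 - (p : ℚ_[p]) / 2 + i)‖ ≤ (p : ℝ)⁻¹ := by
    refine (norm_prod_le_of_mem (fun (i : ℕ) _ => norm_le_one_of_four_mul h2 (n := 5 - 2 * p + 4 * i)
      (by push_cast; ring)) (Finset.mem_range.2 (show r < m by omega))).trans ?_
    rw [norm_eq_norm_intCast_of_four_mul h2 (n := -p) (by rw [hrp]; push_cast; ring)]
    rw [Int.cast_neg, norm_neg, Int.cast_natCast, Padic.norm_p]
  have a3 : ‖∏ i ∈ Finset.range m, (3 / 4 + (i : ℚ_[p]))‖ = 1 := by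
    rw [norm_prod]
    refine Finset.prod_eq_one fun i hi => norm_eq_one_of_four_mul h2 (n := 3 + 4 * i)
      (by push_cast; ring) ?_
    -- 3 + 4i ≤ 2p + 1 forces c ∈ {1, 2}, while p ≡ 1 (mod 4) would require c ≡ 3 (mod 4).
    rintro ⟨c, hc⟩
    have hi := Finset.mem_range.1 hi
    have c0 : 0 < c := by
      by_contra! h
      nlinarith
    have c2 : c < 3 := by
      by_contra! h
      nlinarith
    interval_cases c <;> omega
  have a4 : ‖∏ i ∈ Finset.range m, (1 - (p : ℚ_[p]) / 2 + i)‖ = 1 := by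
    rw [norm_prod]
    refine Finset.prod_eq_one fun i hi => norm_eq_one_of_four_mul h2 (n := 4 * (1 + i) - p * 2)
      (by push_cast; ring) ?_
    have hi := Finset.mem_range.1 hi
    exact fun hd => not_dvd_four_mul h2 (n := 1 + i) (by omega) (by omega)
        ((dvd_sub_left (dvd_mul_right _ _)).1 hd)
  rw [norm_div, norm_mul, norm_mul, a3, a4, mul_one, div_one, zpow_neg, zpow_natCast, ← inv_pow,
    pow_two]
  exact mul_le_mul a1 a2 (norm_nonneg _) (by positivity)

/-- Isolates the single factor divisible by p; the rest is the kind of product that Γ_p telescopes.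
-/
theorem prod_eq_mul_prod_unitPart {f : ℕ → ℤ_[p]} {k j : ℕ} (hj : j < k)
    (hu : ∀ i < k, i ≠ j → IsUnit (f i)) (hn : ¬ IsUnit (f j)) :
    ∏ i ∈ Finset.range k, f i = f j * ∏ i ∈ Finset.range k, unitPart p (f i) := by
  have hj' := Finset.mem_range.2 hj
  rw [← Finset.mul_prod_erase _ _ hj', ← Finset.mul_prod_erase _ (fun i => unitPart p (f i)) hj']
  simp only [unitPart, if_neg hn, one_mul]
  congr 1
  refine Finset.prod_congr rfl fun i hi => ?_
  rw [if_pos (hu i (Finset.mem_range.1 (Finset.mem_of_mem_erase hi)) (Finset.ne_of_mem_erase hi))]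

theorem prod_unitPart_eq {f : ℕ → ℤ_[p]} {k : ℕ} (hu : ∀ i < k, IsUnit (f i)) :
    ∏ i ∈ Finset.range k, unitPart p (f i) = ∏ i ∈ Finset.range k, f i :=
  Finset.prod_congr rfl fun i hi => by rw [unitPart, if_pos (hu i (Finset.mem_range.1 hi))]

theorem four_mul_padicQuarter (h2 : 2 < p) : 4 * padicQuarter p = 1 := by
  apply PadicInt.ext
  push_cast
  rw [coe_padicQuarter p h2]
  norm_num

theorem isUnit_of_four_mul (h2 : 2 < p) {x : ℤ_[p]} {n : ℤ} (h : 4 * x = n)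
    (hn : ¬ (p : ℤ) ∣ n) : IsUnit x := by
  rw [PadicInt.isUnit_iff, PadicInt.norm_def]
  refine norm_eq_one_of_four_mul h2 (n := n) ?_ hn
  exact_mod_cast congrArg ((↑) : ℤ_[p] → ℚ_[p]) h

/-- For `p ≡ 3 (mod 4)` the products in the evaluation of the well-poised sum are expressed by
values of the `p`-adic Gamma function. -/
theorem dixon_value_mul_padicGamma (h2 : 2 < p) {m : ℕ} (hm : 2 * m = p + 1) (hp4 : p % 4 = 3)
    {q h : ℤ_[p]} (hq : 4 * q = 1) (hh : h = 2 * p * q) :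
    ∃ D : ℤ_[p], IsUnit D ∧
      (∏ i ∈ Finset.range m, (3 * q + i)) * ∏ i ∈ Finset.range m, (1 - h + i) = p * D ∧
      (∏ i ∈ Finset.range m, (2 * q + i)) * (∏ i ∈ Finset.range m, (5 * q - h + i)) *
        ((q - h) * (q + h) *
          (padicGamma p (q - h) * padicGamma p (q + h) * padicGamma p q ^ 2)) = p * (3 * D) := by
  obtain ⟨r, hr⟩ : ∃ r, p = 4 * r + 3 := ⟨p / 4, by omega⟩
  obtain rfl : m = 2 * r + 2 := by omega
  have hpr : (p : ℤ_[p]) = 4 * r + 3 := by exact_mod_cast congrArg (Nat.cast (R := ℤ_[p])) hr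
  have hpz : Prime (p : ℤ) := Nat.prime_iff_prime_int.1 hp.out
  have hpu : ∀ x : ℤ_[p], ¬ IsUnit ((p : ℤ_[p]) * x) := fun x => by
    rw [isUnit_iff_not_p_dvd, not_not]
    exact dvd_mul_right _ _
  have hdvd2 : ∀ n : ℤ, (p : ℤ) ∣ 2 * n → (p : ℤ) ∣ n := fun n hn =>
    (hpz.dvd_or_dvd hn).resolve_left (not_dvd_of_pos_of_lt (by norm_num) (by omega))
  have hpm : ((2 * r + 2 : ℕ) : ℤ_[p]) = 2 * q + h := by
    push_cast
    linear_combination (-(2 : ℤ_[p]) * r - 2) * hq + 2 * q * hpr * (-1) - hh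
  have hpr' : (r : ℤ_[p]) = q * p - 3 * q := by
    linear_combination (-(r : ℤ_[p])) * hq - q * hpr
  have q1 : IsUnit q := IsUnit.of_mul_eq_one_right _ hq
  have hphh : h = p * (2 * q) := by rw [hh]; ring
  have uh : ∀ x : ℤ_[p], IsUnit (x - h) ↔ IsUnit x := fun x => by
    rw [isUnit_iff_not_p_dvd, isUnit_iff_not_p_dvd, hphh, dvd_sub_left (dvd_mul_right _ _)]
  have uh' : ∀ x : ℤ_[p], IsUnit (x + h) ↔ IsUnit x := fun x => by
    rw [isUnit_iff_not_p_dvd, isUnit_iff_not_p_dvd, hphh, dvd_add_left (dvd_mul_right _ _)]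
  have u2 : IsUnit (2 * q) := isUnit_of_four_mul h2 (n := 2) (by push_cast; linear_combination 2 * hq)
    (not_dvd_of_pos_of_lt (by norm_num) (by omega))
  -- the four products
  have E1 := padicGamma_add_natCast h2 (2 * q) (2 * r + 2)
  have F1 := prod_eq_mul_prod_unitPart (f := fun i : ℕ => 2 * q + (i : ℤ_[p])) (k := 2 * r + 2) (j := 2 * r + 1)
    (by omega) (fun i hi hij => isUnit_of_four_mul h2 (n := 2 * (1 + 2 * i))
      (by push_cast; linear_combination 2 * hq) (fun hd =>
        not_dvd_of_pos_of_lt (by omega) (by omega) (hdvd2 _ hd)))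
    (by
      have : 2 * q + ((2 * r + 1 : ℕ) : ℤ_[p]) = p * (2 * q) := by
        push_cast at hpm ⊢
        linear_combination hpm + hphh + hq
      rw [this]
      exact hpu _)
  have E3 := padicGamma_add_natCast h2 (3 * q) (2 * r + 2)
  have F3 := prod_eq_mul_prod_unitPart (f := fun i : ℕ => 3 * q + (i : ℤ_[p])) (k := 2 * r + 2) (j := r)
    (by omega) (fun i hi hij => isUnit_of_four_mul h2 (n := 3 + 4 * i)
      (by push_cast; linear_combination 3 * hq) (by
        rintro ⟨c, hc⟩
        have c0 : 0 < c := by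
          by_contra! h
          nlinarith
        have c2 : c < 3 := by
          by_contra! h
          nlinarith
        interval_cases c <;> omega))
    (by
      have : 3 * q + (r : ℤ_[p]) = p * q := by rw [hpr']; ring
      rw [this]
      exact hpu _)
  -- The last factor i = 2r + 1 is excluded: it equals 3/4, which is not a unit when p = 3. Stopping
  -- there also makes the Gamma quotient end at Γ_p(3/4).
  have U2 : ∀ i < 2 * r + 1, IsUnit (5 * q - h + i) := fun i hi => by
    refine isUnit_of_four_mul h2 (n := 5 + 4 * i - 2 * p)
      (by push_cast; rw [hh]; linear_combination (5 - 2 * (p : ℤ_[p])) * hq) ?_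
    rintro ⟨c, hc⟩
    have c0 : -2 < c := by
      by_contra! h
      nlinarith
    have c2 : c < 0 := by
      by_contra! h
      nlinarith
    interval_cases c
    omega
  have E2 := padicGamma_add_natCast h2 (5 * q - h) (2 * r + 1)
  rw [prod_unitPart_eq U2] at E2
  have U4 : ∀ i < 2 * r + 2, IsUnit (1 - h + i) := fun i hi => by
    rw [show 1 - h + i = ((1 + i : ℕ) : ℤ_[p]) - h by push_cast; ring, uh, isUnit_natCast_padicInt]
    exact (Nat.coprime_of_lt_prime (by omega) (by omega) hp.out).symm
  have E4 := padicGamma_add_natCast h2 (1 - h) (2 * r + 2)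
  rw [prod_unitPart_eq U4] at E4
  -- the special values
  have G1 : padicGamma p (1 + h) * padicGamma p (1 - h) = 1 := by
    have e := padicGamma_reflect_p_mul h2 (2 * q)
    rw [← hphh] at e
    have e' := padicGamma_add_one_of_not_isUnit h2 (x := h) (by rw [hphh]; exact hpu _)
    rw [add_comm 1 h, e']
    linear_combination -e
  -- Reflection at 1/2 = -p/2 + m, with 1 - 1/2 = 1/2. The sign is +1 because m is even, i.e. p ≡ 3
  -- (mod 4).
  have G2 : padicGamma p (2 * q) ^ 2 = 1 := by
    have e := padicGamma_reflect_p_mul_add h2 (-2 * q) (i := 2 * r + 1) (by omega)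
    rw [padicGamma_reflect_p_mul h2, show (p : ℤ_[p]) * (-2 * q) + ((2 * r + 1 : ℕ) + 1) = 2 * q by
      push_cast at hpm ⊢
      linear_combination hpm + hh, show 1 - 2 * q = 2 * q by linear_combination -hq] at e
    rw [pow_two, e, Odd.neg_one_pow ⟨r, rfl⟩]
    ring
  have G3 : (padicGamma p q * padicGamma p (3 * q)) ^ 2 = 1 := by
    have e := padicGamma_reflect_sq h2 q
    rwa [show 1 - q = 3 * q by linear_combination -hq] at e
  have G4 : padicGamma p (5 * q - h) = -(q - h) * padicGamma p (q - h) := by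
    rw [← padicGamma_add_one_of_isUnit h2 ((uh q).2 q1)]
    congr 1
    linear_combination hq
  have G5 : padicGamma p (5 * q + h) = -(q + h) * padicGamma p (q + h) := by
    rw [← padicGamma_add_one_of_isUnit h2 ((uh' q).2 q1)]
    congr 1
    linear_combination hq
  have G6 : padicGamma p (6 * q) = -(2 * q) * padicGamma p (2 * q) := by
    rw [← padicGamma_add_one_of_isUnit h2 u2]
    congr 1
    linear_combination hq
  have hev : Even (2 * r + 2) := ⟨r + 1, by ring⟩
  rw [hpm, hev.neg_one_pow, one_mul] at E1 E3 E4
  rw [show ((2 * r + 1 : ℕ) : ℤ_[p]) = 2 * q + h - 1 by rw [← hpm]; push_cast; ring,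
    Odd.neg_one_pow ⟨r, rfl⟩, show 5 * q - h + (2 * q + h - 1) = 3 * q by
      linear_combination hq, G4] at E2
  rw [show 2 * q + (2 * q + h) = 1 + h by linear_combination hq] at E1
  rw [show 3 * q + (2 * q + h) = 5 * q + h by ring, G5] at E3
  rw [show 1 - h + (2 * q + h) = 6 * q by linear_combination -hq, G6] at E4
  have P2 := Finset.prod_range_succ (fun i : ℕ => 5 * q - h + (i : ℤ_[p])) (2 * r + 1)
  rw [show 5 * q - h + ((2 * r + 1 : ℕ) : ℤ_[p]) = 3 * q by
    push_cast at hpm ⊢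
    linear_combination hpm + hq] at P2
  rw [show 2 * q + ((2 * r + 1 : ℕ) : ℤ_[p]) = p * (2 * q) by
    push_cast at hpm ⊢
    linear_combination hpm + hphh + hq] at F1
  rw [show 3 * q + (r : ℤ_[p]) = p * q by rw [hpr']; ring] at F3
  have V3 : IsUnit (∏ i ∈ Finset.range (2 * r + 2), unitPart p (3 * q + i)) := by
    refine isUnit_of_mul_isUnit_left (y := padicGamma p (3 * q)) ?_
    rw [← E3]
    exact ((uh' q).2 q1).neg.mul (isUnit_padicGamma h2 _)
  have V4 : IsUnit (∏ i ∈ Finset.range (2 * r + 2), (1 - h + (i : ℤ_[p]))) := by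
    refine isUnit_of_mul_isUnit_left (y := padicGamma p (1 - h)) ?_
    rw [← E4]
    exact u2.neg.mul (isUnit_padicGamma h2 _)
  -- D is the denominator with p removed: the non-unit factor of (3/4)_m is p/4 = pq.
  refine ⟨q * (∏ i ∈ Finset.range (2 * r + 2), unitPart p (3 * q + i)) *
    ∏ i ∈ Finset.range (2 * r + 2), (1 - h + (i : ℤ_[p])), (q1.mul V3).mul V4, ?_, ?_⟩
  · rw [F3]; ring
  rw [F1, P2]
  clear F1 F3 P2 U2 U4 V3 V4
  generalize (∏ i ∈ Finset.range (2 * r + 2), unitPart p (2 * q + i)) = X1 at *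
  generalize (∏ i ∈ Finset.range (2 * r + 1), (5 * q - h + (i : ℤ_[p]))) = X2 at *
  generalize (∏ i ∈ Finset.range (2 * r + 2), unitPart p (3 * q + i)) = X3 at *
  generalize (∏ i ∈ Finset.range (2 * r + 2), (1 - h + (i : ℤ_[p]))) = X4 at *
  -- Γ_p(1/2) is its own inverse and Γ_p(1-h) is inverse to Γ_p(1+h), so these values end up only
  -- inside D.
  have e1 : X1 = padicGamma p (1 + h) * padicGamma p (2 * q) := by
    linear_combination -padicGamma p (2 * q) * E1 - X1 * G2
  have e4 : X4 = -(2 * q) * padicGamma p (2 * q) * padicGamma p (1 + h) := by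
    linear_combination -padicGamma p (1 + h) * E4 - X4 * G1
  have e2 : X2 * ((q - h) * padicGamma p (q - h)) = padicGamma p (3 * q) := by
    linear_combination -E2
  have e3 : (q + h) * padicGamma p (q + h) = -(X3 * padicGamma p (3 * q)) := by
    linear_combination -E3
  calc _ = p * (2 * q) * X1 * (3 * q) * (X2 * ((q - h) * padicGamma p (q - h))) *
        ((q + h) * padicGamma p (q + h)) * padicGamma p q ^ 2 := by ring
    _ = _ := by
      rw [e2, e3, e1, e4]
      linear_combination (-6 * (p : ℤ_[p]) * q ^ 2 * padicGamma p (1 + h) * padicGamma p (2 * q) *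
        X3) * G3

theorem norm_dixon_sub_le_of_mod_four_eq_three (h2 : 2 < p) {m : ℕ} (hm : 2 * m = p + 1)
    (hp4 : p % 4 = 3) :
    ‖(∏ i ∈ Finset.range m, (1 / 2 + (i : ℚ_[p]))) *
        (∏ i ∈ Finset.range m, (5 / 4 - (p : ℚ_[p]) / 2 + i)) /
        ((∏ i ∈ Finset.range m, (3 / 4 + (i : ℚ_[p]))) *
          ∏ i ∈ Finset.range m, (1 - (p : ℚ_[p]) / 2 + i)) -
      48 / (padicGamma p (padicQuarter p) : ℚ_[p]) ^ 4‖ ≤ (p : ℝ) ^ (-(2 : ℕ) : ℤ) := by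
  set q := padicQuarter p with hq
  have hq4 := four_mul_padicQuarter h2
  rw [← hq] at hq4
  have hqc : (q : ℚ_[p]) = 1 / 4 := coe_padicQuarter p h2
  obtain ⟨h, hh⟩ : ∃ h : ℤ_[p], h = 2 * p * q := ⟨_, rfl⟩
  have hhc : (h : ℚ_[p]) = p / 2 := by rw [hh]; push_cast; rw [hqc]; ring
  obtain ⟨D, hD, e1, e2⟩ := dixon_value_mul_padicGamma h2 hm hp4 hq4 hh
  obtain ⟨c, hc⟩ := p_sq_dvd_padicGamma_midpoint h2 (q - h) h
    (by rw [hh]; linear_combination (p : ℤ_[p]) * hq4)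
  rw [sub_add_cancel, show q - h + p = q + h by rw [hh]; linear_combination -(p : ℤ_[p]) * hq4]
    at hc
  have u1 : IsUnit ((q - h) * (q + h) *
      (padicGamma p (q - h) * padicGamma p (q + h) * padicGamma p q ^ 4)) := by
    have q1 : IsUnit q := IsUnit.of_mul_eq_one_right _ hq4
    have hd : (p : ℤ_[p]) ∣ h := ⟨2 * q, by rw [hh]; ring⟩
    refine (IsUnit.mul ?_ ?_).mul (((isUnit_padicGamma h2 _).mul (isUnit_padicGamma h2 _)).mul
      ((isUnit_padicGamma h2 _).pow 4))
    · rwa [isUnit_iff_not_p_dvd, dvd_sub_left hd, ← isUnit_iff_not_p_dvd]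
    · rwa [isUnit_iff_not_p_dvd, dvd_add_left hd, ← isUnit_iff_not_p_dvd]
  have hn : ∀ {x : ℤ_[p]}, IsUnit x → ‖(x : ℚ_[p])‖ = 1 := fun hx => PadicInt.isUnit_iff.1 hx
  have hp0 : (p : ℚ_[p]) ≠ 0 := by exact_mod_cast hp.out.ne_zero
  have hD0 : (D : ℚ_[p]) ≠ 0 := norm_ne_zero_iff.1 (by rw [hn hD]; exact one_ne_zero)
  have hu0 : ((((q - h) * (q + h) * (padicGamma p (q - h) * padicGamma p (q + h) *
      padicGamma p q ^ 4) : ℤ_[p])) : ℚ_[p]) ≠ 0 :=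
    norm_ne_zero_iff.1 (by rw [hn u1]; exact one_ne_zero)
  have c0 : (∏ i ∈ Finset.range m, (1 / 2 + (i : ℚ_[p]))) *
      (∏ i ∈ Finset.range m, (5 / 4 - (p : ℚ_[p]) / 2 + i)) =
      (((∏ i ∈ Finset.range m, (2 * q + i)) *
        (∏ i ∈ Finset.range m, (5 * q - h + i)) : ℤ_[p]) : ℚ_[p]) := by
    simp only [PadicInt.coe_mul, coe_prod_padicInt, PadicInt.coe_add,
      PadicInt.coe_sub, PadicInt.coe_natCast, hhc, hqc, coe_ofNat_padicInt]
    norm_num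
  have c1 : (∏ i ∈ Finset.range m, (3 / 4 + (i : ℚ_[p]))) *
      (∏ i ∈ Finset.range m, (1 - (p : ℚ_[p]) / 2 + i)) =
      (((∏ i ∈ Finset.range m, (3 * q + i)) *
        (∏ i ∈ Finset.range m, (1 - h + i)) : ℤ_[p]) : ℚ_[p]) := by
    simp only [PadicInt.coe_mul, coe_prod_padicInt, PadicInt.coe_add,
      PadicInt.coe_sub, PadicInt.coe_natCast, hhc, hqc, coe_ofNat_padicInt, PadicInt.coe_one]
    norm_num
  -- The p^2 collects both errors: (1/4-h)(1/4+h) = 1/16 - p^2/4, and the midpoint congruence with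
  -- remainder `c`.
  have key : (∏ i ∈ Finset.range m, (1 / 2 + (i : ℚ_[p]))) *
      (∏ i ∈ Finset.range m, (5 / 4 - (p : ℚ_[p]) / 2 + i)) /
      ((∏ i ∈ Finset.range m, (3 / 4 + (i : ℚ_[p]))) *
        ∏ i ∈ Finset.range m, (1 - (p : ℚ_[p]) / 2 + i)) - 48 / (padicGamma p q : ℚ_[p]) ^ 4 =
      (p : ℚ_[p]) ^ 2 * ((12 * padicGamma p (q - h) * padicGamma p (q + h) - 3 * c : ℤ_[p]) : ℚ_[p])
        / ((((q - h) * (q + h) * (padicGamma p (q - h) * padicGamma p (q + h) *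
          padicGamma p q ^ 4) : ℤ_[p])) : ℚ_[p]) := by
    rw [c0, c1, e1]
    have e2' := congrArg ((↑) : ℤ_[p] → ℚ_[p]) e2
    have hc' := congrArg ((↑) : ℤ_[p] → ℚ_[p]) hc
    rw [PadicInt.coe_mul] at e2'
    generalize ((((∏ i ∈ Finset.range m, (2 * q + i)) *
        (∏ i ∈ Finset.range m, (5 * q - h + i)) : ℤ_[p])) : ℚ_[p]) = N at *
    push_cast at e2' hc' hu0 ⊢
    rw [hqc, hhc] at *
    generalize (padicGamma p q : ℚ_[p]) = g at *
    generalize (padicGamma p (q - h) : ℚ_[p]) = s at *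
    generalize (padicGamma p (q + h) : ℚ_[p]) = t at *
    have hN : N = p * (3 * D) / ((1 / 4 - (p : ℚ_[p]) / 2) * (1 / 4 + (p : ℚ_[p]) / 2) *
        (s * t * g ^ 2)) := by
      rw [eq_div_iff]
      · exact e2'
      · intro h0
        apply hu0
        linear_combination g ^ 2 * h0
    simp only [mul_ne_zero_iff, ne_eq, pow_eq_zero_iff, OfNat.ofNat_ne_zero, not_false_eq_true]
      at hu0
    obtain ⟨⟨w1, w2⟩, ⟨w3, w4⟩, w5⟩ := hu0
    rw [hN]
    generalize hA : 1 / 4 - (p : ℚ_[p]) / 2 = A at *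
    generalize hB : 1 / 4 + (p : ℚ_[p]) / 2 = B at *
    have hAB : A * B = 1 / 16 - p ^ 2 / 4 := by rw [← hA, ← hB]; ring
    rw [show (p : ℚ_[p]) * (3 * D) / (A * B * (s * t * g ^ 2)) / (p * D) - 48 / g ^ 4 =
      (3 * g ^ 2 - 48 * (A * B) * (s * t)) / (A * B * (s * t * g ^ 4)) by field_simp]
    congr 1
    rw [hAB]
    linear_combination -3 * hc'
  rw [key, norm_div, norm_mul, hn u1, div_one, Padic.norm_p_pow]
  exact mul_le_of_le_one_right (by positivity) (PadicInt.norm_le_one _)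

end Evaluation

/-! ### Conclusion by the ultrametric inequality -/

theorem mainTheorem1 (p : ℕ) [Fact p.Prime] (hp : 2 < p) :
    (p % 4 = 1 →
      PadicModEq p 2
        (∑ k ∈ Finset.Icc 0 ((p - 1) / 2), (catalan k : ℚ_[p]) ^ 3 / 64 ^ k)
        8) ∧
    (p % 4 = 3 →
      PadicModEq p 2
        (∑ k ∈ Finset.Icc 0 ((p - 1) / 2), (catalan k : ℚ_[p]) ^ 3 / 64 ^ k)
        (8 - 384 / (padicGamma p (padicQuarter p) : ℚ_[p]) ^ 4)) := by
  obtain ⟨s, hs⟩ := (Fact.out : p.Prime).odd_of_ne_two (by omega)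
  have hm : 2 * (s + 1) = p + 1 := by omega
  have h8 : ‖(8 : ℚ_[p])‖ ≤ 1 := by exact_mod_cast Padic.norm_int_le_one (p := p) 8
  have hT := norm_sum_cube_sub_dixon_le hp hm
  rw [show (p - 1) / 2 = s by omega, sum_catalan_cube]
  constructor <;> intro h4 <;> rw [padicModEq_iff_norm_le]
  · have hX := norm_dixon_le_of_mod_four_eq_one hp hm h4
    have := (IsUltrametricDist.norm_add_le_max _ _).trans (max_le hT hX)
    rw [sub_add_cancel] at this
    rw [sub_right_comm, sub_self, zero_sub, norm_neg, norm_mul]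
    exact (mul_le_of_le_one_left (norm_nonneg _) h8).trans this
  · have hX := norm_dixon_sub_le_of_mod_four_eq_three hp hm h4
    have := (IsUltrametricDist.norm_add_le_max _ _).trans (max_le hT hX)
    rw [sub_add_sub_cancel] at this
    rw [sub_sub_sub_cancel_left, show (384 : ℚ_[p]) = 8 * 48 by norm_num, mul_div_assoc, ← mul_sub,
      norm_mul, norm_sub_rev]
    exact (mul_le_of_le_one_left (norm_nonneg _) h8).trans this
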